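/- Let $p\ge 0$, let $x_1,\dots,x_p\in\mathbb{R}^3$ (terminals) and $f_1,\dots,f_p\in\mathbb{R}^3$ (forces) form a balanced system, that is, $\sum_i f_i=0$ and $\sum_i x_i\times f_i=0$, and put $f=(f_1^T,\dots,f_p^T)^T\in\mathbb{R}^{3p}$. A purely elastic $p$-terminal network with these terminals consists of finitely many interior nodes $x_{p+1},\dots,x_{p+m}\in\mathbb{R}^3$ ($m\ge 0$), different from each other and from the terminals, and of spring constants $k_{ij}=k_{ji}\ge 0$ between the nodes, where $k_{ij}=0$ means that there is no spring and $k_{ij}\neq 0$ is allowed only if $x_i\ne x_j$. Its quadratic form is $$q(u)=\sum_{\{i,j\}:\,k_{ij}>0}k_{ij}\Big((u_i-u_j)\cdot\frac{x_i-x_j}{\|x_i-x_j\|}\Big)^2,\qquad u=(u_1,\dots,u_{p+m}),\ u_i\in\mathbb{R}^3,$$ and its response matrix is the symmetric matrix $W\in\mathbb{R}^{3p\times 3p}$ with $$u_B^TWu_B=\inf_{u_I\in\mathbb{R}^{3m}}q(u_B,u_I)\qquad\text{for all }u_B\in\mathbb{R}^{3p},$$ where $u_B$ and $u_I$ are the displacements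 of the terminals and of the interior nodes. Then for every $\epsilon>0$ and every finite set $S\subset\mathbb{R}^3$ there are a purely elastic network with terminals $x_1,\dots,x_p$ and a constant $c>0$ such that its response matrix is $$W=c\,ff^T,$$ and such that every interior node has distance at most $\epsilon$ from the convex hull of $\{x_1,\dots,x_p\}$ and does not belong to $S$. -/

import Mathlib

/-- Physical space `ℝ³` with its Euclidean norm. -/
abbrev Space3 : Type := EuclideanSpace ℝ (Fin 3)

/-- A balanced system of forces `f i` supported at the points `x i`:
the total force and the total torque vanish. -/
def IsBalanced {p : ℕ} (x f : Fin p → Space3) : Prop :=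
  (∑ i, f i = 0) ∧ (∑ i, crossProduct (x i).ofLp (f i).ofLp = 0)

/-- A finite, purely elastic network (springs, no masses) in `ℝ³` with terminal nodes `x i`.
The nodes are the terminals `Sum.inl i` and the interior nodes `Sum.inr j`.
The number `k a b` is the spring constant of the spring joining the nodes `a` and `b`;
`k a b = 0` means that there is no spring between them. The interior nodes are points that
differ from each other and from the terminals, and a spring joins two different points. -/
structure ElasticNetwork {p : ℕ} (x : Fin p → Space3) where
  /-- number of interior nodes -/
  m : ℕ
  /-- positions of the interior nodes -/
  interior : Fin m → Space3
  interior_injective : Function.Injective interior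
  interior_ne_terminal : ∀ j i, interior j ≠ x i
  /-- spring constants -/
  k : Fin p ⊕ Fin m → Fin p ⊕ Fin m → ℝ
  k_symm : ∀ a b, k a b = k b a
  k_nonneg : ∀ a b, 0 ≤ k a b
  ne_of_spring : ∀ a b, k a b ≠ 0 → Sum.elim x interior a ≠ Sum.elim x interior b

namespace ElasticNetwork

variable {p : ℕ} {x : Fin p → Space3}

/-- The type of all nodes, terminal and interior. -/
abbrev Node (N : ElasticNetwork x) : Type := Fin p ⊕ Fin N.m

/-- Position of a node. -/
def pos (N : ElasticNetwork x) : N.Node → Space3 := Sum.elim x N.interior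

/-- The unit vector `(x_b - x_a) / ‖x_b - x_a‖` of the spring from node `a` to node `b`. -/
noncomputable def dir (N : ElasticNetwork x) (a b : N.Node) : Space3 :=
  ‖N.pos b - N.pos a‖⁻¹ • (N.pos b - N.pos a)

/-- The vector with block `-n` at node `a`, block `n` at node `b` and zero blocks elsewhere,
where `n = dir a b`. Its product with a displacement vector is the elongation of the spring. -/
noncomputable def elongation (N : ElasticNetwork x) (a b : N.Node) : N.Node × Fin 3 → ℝ :=
  fun c => ((if c.1 = b then 1 else 0) - (if c.1 = a then 1 else 0)) * N.dir a b c.2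

/-- The stiffness matrix of a single spring, with blocks `k n nᵀ` at `(a, a)` and `(b, b)` and
`-k n nᵀ` at `(a, b)` and `(b, a)`. -/
noncomputable def springStiffness (N : ElasticNetwork x) (a b : N.Node) :
    Matrix (N.Node × Fin 3) (N.Node × Fin 3) ℝ :=
  N.k a b • Matrix.vecMulVec (N.elongation a b) (N.elongation a b)

/-- The stiffness matrix of the network (all nodes regarded as terminals): the sum of the
stiffness matrices of its springs. The double sum meets every spring twice, as `(a, b)` and
as `(b, a)`, whence the factor `1 / 2`. -/
noncomputable def stiffness (N : ElasticNetwork x) :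
    Matrix (N.Node × Fin 3) (N.Node × Fin 3) ℝ :=
  (1 / 2 : ℝ) • ∑ a, ∑ b, N.springStiffness a b

/-- The displacement of all nodes with given terminal and interior displacements. -/
def joinDisp (N : ElasticNetwork x) (uB : Fin p × Fin 3 → ℝ) (uI : Fin N.m × Fin 3 → ℝ) :
    N.Node × Fin 3 → ℝ :=
  fun c => Sum.elim (fun i => uB (i, c.2)) (fun j => uI (j, c.2)) c.1

/-- The quadratic form `uᵀ A u` of the stiffness matrix, which is twice the elastic energy. -/
noncomputable def quadForm (N : ElasticNetwork x) (u : N.Node × Fin 3 → ℝ) : ℝ :=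
  u ⬝ᵥ N.stiffness.mulVec u

/-- `W` is the (static) response matrix of the network at its terminals: the symmetric matrix
whose quadratic form at `uB` is the infimum of the quadratic form of the network over all
displacements of the interior nodes. -/
def IsResponse (N : ElasticNetwork x)
    (W : Matrix (Fin p × Fin 3) (Fin p × Fin 3) ℝ) : Prop :=
  W.IsSymm ∧ ∀ uB : Fin p × Fin 3 → ℝ,
    IsGLB (Set.range fun uI : Fin N.m × Fin 3 → ℝ => N.quadForm (N.joinDisp uB uI))
      (uB ⬝ᵥ W.mulVec uB)

end ElasticNetwork

/-- The vector `(f₁ᵀ, …, f_pᵀ)ᵀ` of all force components. -/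
def stackForces {p : ℕ} (f : Fin p → Space3) : Fin p × Fin 3 → ℝ :=
  fun c => f c.1 c.2

/-! The theorem reduces to a question about bar frameworks. Give every bar the spring constant 1.
Suppose that the terminal displacements extending to an infinitesimal flex are exactly the
hyperplane `f ⬝ᵥ u = 0`. Then the minimized energy is a quadratic form that vanishes exactly there,
hence a positive multiple of `(f ⬝ᵥ u)²` (`exists_isGLB_sq`, `exists_network_of_framework`).

Such a framework is a chain of rigid bodies, one for each nonzero force. Body `k` is attached to its
terminal by a single bar along the line of action of `F k`, so only the work of `F k` is passed on.
Consecutive bodies share a hinge, and one extra bar with force `g` closes the chain. Each hinge axis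
`d k` is chosen so that the resultant of `g` and the preceding forces has no moment about it.
Therefore no work is lost at hinges, and for a balanced system the total work of the forces equals
`g` times the relative displacement of the ends of the closing bar (`BodyChain.sum_work`). If that
bar keeps its length, the total work is zero. Conversely, `F k` does have a moment about `d k`, so
rotations about the hinges realize any prescribed works (`BodyChain.exists_motion`), and if these
sum to zero the closing bar is unstrained.

Such axes exist for generic `g`, and every node can be moved along a line, so all nodes can be kept
distinct, off `S` and near the terminals (`BodyChain.exists_pos_injective`). -/

open Matrix

/-! ### Partial minimization of a sum of squares -/

/-- If the quadratic form `∑ (L e u)²` on `B × I` controls the linear form `φ` of the first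
component, and every zero of `φ` extends to a zero of the quadratic form, then minimizing over the
second component leaves a positive multiple of `φ²`. -/
theorem exists_isGLB_sq {κ B I : Type*} [Fintype κ] [AddCommGroup B] [Module ℝ B]
    [AddCommGroup I] [Module ℝ I] (L : κ → (B × I) →ₗ[ℝ] ℝ) (φ : B →ₗ[ℝ] ℝ) (hφ : φ ≠ 0)
    (h₁ : ∀ u, (∀ e, L e u = 0) → φ u.1 = 0)
    (h₂ : ∀ b, φ b = 0 → ∃ i, ∀ e, L e (b, i) = 0) :
    ∃ c : ℝ, 0 < c ∧ ∀ b, IsGLB (Set.range fun i => ∑ e, L e (b, i) ^ 2) (c * φ b ^ 2) := by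
  obtain ⟨v₀, hv₀⟩ : ∃ v, φ v ≠ 0 := by
    by_contra! h
    exact hφ (LinearMap.ext h)
  obtain ⟨v, hv⟩ : ∃ v, φ v = 1 := ⟨(φ v₀)⁻¹ • v₀, by simp [hv₀]⟩
  -- By `h₁` the common kernel of the `L e` lies in the kernel of `φ`, so `φ` is a combination of
  -- the `L e`; Cauchy–Schwarz then bounds the infimum at `v` away from zero.
  have hspan : φ ∘ₗ LinearMap.fst ℝ B I ∈ Submodule.span ℝ (Set.range L) := by
    apply mem_span_of_iInf_ker_le_ker
    intro u hu
    simp only [Submodule.mem_iInf, LinearMap.mem_ker] at hu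
    simpa using h₁ u hu
  obtain ⟨s, hs⟩ := (Submodule.mem_span_range_iff_exists_fun ℝ).1 hspan
  have hs' : ∀ u, ∑ e, s e * L e u = φ u.1 := by
    intro u
    have := LinearMap.congr_fun hs u
    simpa [LinearMap.sum_apply] using this
  have hcs : ∀ u, φ u.1 ^ 2 ≤ (∑ e, s e ^ 2) * ∑ e, L e u ^ 2 := by
    intro u
    rw [← hs' u]
    exact Finset.sum_mul_sq_le_sq_mul_sq _ _ _
  have hK : 0 < ∑ e, s e ^ 2 := by
    refine lt_of_le_of_ne (Finset.sum_nonneg fun e _ => sq_nonneg _) fun h => ?_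
    have := hcs (v, 0)
    rw [← h, hv] at this
    norm_num at this
  have hlow : (∑ e, s e ^ 2)⁻¹ ∈ lowerBounds (Set.range fun i => ∑ e, L e (v, i) ^ 2) := by
    rintro _ ⟨i, rfl⟩
    have := hcs (v, i)
    rw [hv] at this
    rw [inv_le_iff_one_le_mul₀' hK]
    simpa using this
  have hglb := isGLB_csInf (Set.range_nonempty fun i => ∑ e, L e (v, i) ^ 2) ⟨_, hlow⟩
  set c := sInf (Set.range fun i => ∑ e, L e (v, i) ^ 2) with hc
  have hcpos : 0 < c := lt_of_lt_of_le (inv_pos.2 hK) (hglb.2 hlow)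
  refine ⟨c, hcpos, fun b => ?_⟩
  -- Adding this zero-energy extension turns the problem at `b` into the problem at `v` scaled by `φ
  -- b`, through the substitution `i ↦ φ b • i + j`, which is bijective unless `φ b = 0`.
  obtain ⟨j, hj⟩ := h₂ (b - φ b • v) (by simp [hv])
  have key : ∀ i e, L e (b, φ b • i + j) = φ b * L e (v, i) := by
    intro i e
    have : ((b, φ b • i + j) : B × I) = φ b • (v, i) + (b - φ b • v, j) := by
      ext <;> simp
    rw [this, map_add, hj, map_smul]
    simp
  by_cases hb : φ b = 0
  · have h0 : ∀ e, L e (b, j) = 0 := by simpa [hb] using key 0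
    refine ⟨?_, fun l hl => ?_⟩
    · rintro _ ⟨i, rfl⟩
      simpa [hb] using Finset.sum_nonneg fun e (_ : e ∈ Finset.univ) => sq_nonneg (L e (b, i))
    · have := hl ⟨j, rfl⟩
      simpa [h0, hb] using this
  · have key' : ∀ i, ∑ e, L e (b, φ b • i + j) ^ 2 = φ b ^ 2 * ∑ e, L e (v, i) ^ 2 := by
      intro i
      simp only [key, mul_pow, Finset.mul_sum]
    have hb2 : 0 < φ b ^ 2 := by positivity
    refine ⟨?_, fun l hl => ?_⟩
    · rintro _ ⟨i, rfl⟩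
      have hi : i = φ b • ((φ b)⁻¹ • (i - j)) + j := by
        rw [smul_smul, mul_inv_cancel₀ hb]
        simp
      dsimp only
      rw [hi, key', mul_comm]
      exact mul_le_mul_of_nonneg_left (hglb.1 ⟨_, rfl⟩) hb2.le
    · have : l / φ b ^ 2 ≤ c := by
        refine hglb.2 ?_
        rintro _ ⟨i, rfl⟩
        rw [div_le_iff₀' hb2]
        dsimp only
        rw [← key']
        exact hl ⟨_, rfl⟩
      rw [div_le_iff₀ hb2] at this
      exact this

/-! ### From bar frameworks to elastic networks -/

namespace ElasticNetwork

variable {p : ℕ} {x : Fin p → Space3}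

theorem elongation_dotProduct (N : ElasticNetwork x) (a b : N.Node) (u : N.Node × Fin 3 → ℝ) :
    N.elongation a b ⬝ᵥ u =
      ‖N.pos b - N.pos a‖⁻¹ * ((N.pos b - N.pos a).ofLp ⬝ᵥ fun l => u (b, l) - u (a, l)) := by
  simp only [dotProduct, elongation, Fintype.sum_prod_type, dir, PiLp.smul_apply, smul_eq_mul,
    Finset.mul_sum]
  rw [Finset.sum_comm]
  refine Finset.sum_congr rfl fun l _ => ?_
  have : ∀ d : N.Node, ((if d = b then (1 : ℝ) else 0) - if d = a then 1 else 0) *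
      (‖N.pos b - N.pos a‖⁻¹ * (N.pos b - N.pos a) l) * u (d, l) =
      (if d = b then ‖N.pos b - N.pos a‖⁻¹ * (N.pos b - N.pos a) l * u (d, l) else 0) -
      (if d = a then ‖N.pos b - N.pos a‖⁻¹ * (N.pos b - N.pos a) l * u (d, l) else 0) := by
    intro d
    split_ifs <;> ring
  simp only [this, Finset.sum_sub_distrib, Finset.sum_ite_eq', Finset.mem_univ, if_true]
  ring

theorem quadForm_eq (N : ElasticNetwork x) (u : N.Node × Fin 3 → ℝ) :
    N.quadForm u = 1 / 2 * ∑ e : N.Node × N.Node, N.k e.1 e.2 * (N.elongation e.1 e.2 ⬝ᵥ u) ^ 2 := by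
  simp only [quadForm, stiffness, springStiffness, smul_mulVec, sum_mulVec, dotProduct_smul,
    dotProduct_sum, vecMulVec_mulVec, smul_eq_mul, Fintype.sum_prod_type]
  congr 1
  refine Finset.sum_congr rfl fun a _ => Finset.sum_congr rfl fun b _ => ?_
  simp only [op_smul_eq_smul, smul_eq_mul, dotProduct_comm u]
  ring

end ElasticNetwork

/-- A framework whose infinitesimal flexes are exactly the extensions of the terminal
displacements orthogonal to `f` gives an elastic network with response `c f fᵀ`. -/
theorem exists_network_of_framework {p : ℕ} {x f : Fin p → Space3} (hf : f ≠ 0) {ι : Type}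
    [Fintype ι] (P : ι → Space3) (hP : Function.Injective P) (hPx : ∀ j i, P j ≠ x i)
    (adj : Fin p ⊕ ι → Fin p ⊕ ι → Prop) (hsymm : ∀ a b, adj a b → adj b a)
    (hne : ∀ a b, adj a b → Sum.elim x P a ≠ Sum.elim x P b)
    (h₁ : ∀ u : Fin p ⊕ ι → Fin 3 → ℝ,
      (∀ a b, adj a b → (Sum.elim x P b - Sum.elim x P a).ofLp ⬝ᵥ (u b - u a) = 0) →
      ∑ i, (f i).ofLp ⬝ᵥ u (Sum.inl i) = 0)
    (h₂ : ∀ v : Fin p → Fin 3 → ℝ, ∑ i, (f i).ofLp ⬝ᵥ v i = 0 →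
      ∃ u : Fin p ⊕ ι → Fin 3 → ℝ, (∀ i, u (Sum.inl i) = v i) ∧
        ∀ a b, adj a b → (Sum.elim x P b - Sum.elim x P a).ofLp ⬝ᵥ (u b - u a) = 0) :
    ∃ (N : ElasticNetwork x) (c : ℝ), 0 < c ∧
      N.IsResponse (c • Matrix.vecMulVec (stackForces f) (stackForces f)) ∧
      ∀ j, ∃ i, N.interior j = P i := by
  classical
  let e := Fintype.equivFin ι
  let g : Fin p ⊕ Fin (Fintype.card ι) ≃ Fin p ⊕ ι := Equiv.sumCongr (Equiv.refl _) e.symm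
  have hg : ∀ a, Sum.elim x (P ∘ e.symm) a = Sum.elim x P (g a) := by rintro (a | a) <;> rfl
  let N : ElasticNetwork x :=
    { m := Fintype.card ι
      interior := P ∘ e.symm
      interior_injective := hP.comp e.symm.injective
      interior_ne_terminal := fun j i => hPx _ i
      k := fun a b => if adj (g a) (g b) then 1 else 0
      k_symm := fun a b => if_congr ⟨hsymm _ _, hsymm _ _⟩ rfl rfl
      k_nonneg := fun a b => by split_ifs <;> norm_num
      ne_of_spring := fun a b h => by
        rw [hg, hg]
        exact hne _ _ (by by_contra h'; simp [h'] at h) }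
  have hpos : ∀ a, N.pos a = Sum.elim x P (g a) := hg
  -- The spring constants are 0 or 1, so `k ^ 2 = k` and the squares of these forms are the terms of
  -- the energy.
  let L : N.Node × N.Node →
      ((Fin p × Fin 3 → ℝ) × (Fin N.m × Fin 3 → ℝ)) →ₗ[ℝ] ℝ := fun d =>
    { toFun := fun u => N.k d.1 d.2 * (N.elongation d.1 d.2 ⬝ᵥ N.joinDisp u.1 u.2)
      map_add' := fun u v => by
        rw [← mul_add, ← dotProduct_add]
        congr 2
        ext ⟨a | a, l⟩ <;> rfl
      map_smul' := fun t u => by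
        have : N.joinDisp (t • u).1 (t • u).2 = t • N.joinDisp u.1 u.2 := by
          ext ⟨a | a, l⟩ <;> rfl
        rw [this, dotProduct_smul]
        simp only [smul_eq_mul, RingHom.id_apply]
        ring }
  have hL : ∀ d u, L d u = N.k d.1 d.2 * (N.elongation d.1 d.2 ⬝ᵥ N.joinDisp u.1 u.2) :=
    fun _ _ => rfl
  have hL0 : ∀ d u, L d u = 0 ↔ (adj (g d.1) (g d.2) →
      (Sum.elim x P (g d.2) - Sum.elim x P (g d.1)).ofLp ⬝ᵥ
        (fun l => N.joinDisp u.1 u.2 (d.2, l) - N.joinDisp u.1 u.2 (d.1, l)) = 0) := by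
    intro d u
    have hk : N.k d.1 d.2 = if adj (g d.1) (g d.2) then 1 else 0 := rfl
    rw [hL, hk, ElasticNetwork.elongation_dotProduct, hpos, hpos]
    by_cases h : adj (g d.1) (g d.2)
    · have : ‖Sum.elim x P (g d.2) - Sum.elim x P (g d.1)‖ ≠ 0 :=
        norm_ne_zero_iff.2 (sub_ne_zero.2 (hne _ _ h).symm)
      simp [h, this]
    · simp [h]
  have hQ : ∀ u, N.quadForm (N.joinDisp u.1 u.2) = 1 / 2 * ∑ d, L d u ^ 2 := by
    intro u
    rw [ElasticNetwork.quadForm_eq]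
    congr 1
    refine Finset.sum_congr rfl fun d _ => ?_
    rw [hL]
    have hk : N.k d.1 d.2 = if adj (g d.1) (g d.2) then 1 else 0 := rfl
    rw [hk]
    split_ifs <;> simp
  let φ : (Fin p × Fin 3 → ℝ) →ₗ[ℝ] ℝ := dotProductBilin ℝ ℝ (stackForces f)
  have hφ' : ∀ b, φ b = stackForces f ⬝ᵥ b := fun _ => rfl
  have hφs : ∀ b, φ b = ∑ i, (f i).ofLp ⬝ᵥ fun l => b (i, l) := by
    intro b
    rw [hφ']
    simp only [dotProduct, Fintype.sum_prod_type, stackForces]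
  have hφ : φ ≠ 0 := by
    intro h
    have h0 : stackForces f ⬝ᵥ stackForces f = 0 := by rw [← hφ', h]; rfl
    rw [dotProduct_self_eq_zero] at h0
    apply hf
    ext i l
    exact congrFun h0 (i, l)
  obtain ⟨c, hc, hglb⟩ := exists_isGLB_sq L φ hφ
    (by
      intro u hu
      rw [hφs]
      refine h₁ (fun a l => N.joinDisp u.1 u.2 (g.symm a, l)) fun a b hab => ?_
      have := (hL0 (g.symm a, g.symm b) u).1 (hu _)
      simp only [Equiv.apply_symm_apply] at this
      exact this hab)
    (by
      intro b hb
      rw [hφs] at hb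
      obtain ⟨u, hub, hu⟩ := h₂ _ hb
      have hj : ∀ a l, N.joinDisp b (fun d => u (Sum.inr (e.symm d.1)) d.2) (a, l) = u (g a) l := by
        rintro (a | a) l
        · exact (congrFun (hub a) l).symm
        · rfl
      refine ⟨fun d => u (Sum.inr (e.symm d.1)) d.2, fun d => ?_⟩
      rw [hL0]
      intro had
      simp only [hj]
      exact hu _ _ had)
  -- The sum over ordered pairs counts each spring twice, hence `c / 2`.
  refine ⟨N, c / 2, by positivity, ⟨?_, fun b => ?_⟩, fun j => ⟨_, rfl⟩⟩
  · rw [Matrix.IsSymm, transpose_smul, transpose_vecMulVec]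
  · have h := hglb b
    have hval : b ⬝ᵥ ((c / 2) • vecMulVec (stackForces f) (stackForces f)) *ᵥ b =
        1 / 2 * (c * φ b ^ 2) := by
      rw [hφ', smul_mulVec, dotProduct_smul, vecMulVec_mulVec, op_smul_eq_smul, dotProduct_smul,
        dotProduct_comm b]
      simp only [smul_eq_mul]
      ring
    rw [hval]
    refine ⟨?_, fun l hl => ?_⟩
    · rintro _ ⟨i, rfl⟩
      dsimp only
      rw [hQ (b, i)]
      exact mul_le_mul_of_nonneg_left (h.1 ⟨i, rfl⟩) (by norm_num)
    · have : 2 * l ≤ c * φ b ^ 2 := by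
        refine h.2 ?_
        rintro _ ⟨i, rfl⟩
        have := hl ⟨i, rfl⟩
        dsimp only at this
        rw [hQ (b, i)] at this
        dsimp only
        linarith
      linarith

/-! ### General position of points and vectors -/

/-- Choice of pairwise different points on given lines, near the base points of the lines. -/
theorem exists_injective_add_smul {E ι : Type*} [NormedAddCommGroup E] [NormedSpace ℝ E] [Finite ι]
    {U : Set E} (hU : IsOpen U) {bad : Set E} (hbad : bad.Finite) (c v : ι → E)
    (hc : ∀ i, c i ∈ U) (hv : ∀ i, v i ≠ 0) :
    ∃ τ : ι → ℝ, (∀ i, τ i ≠ 0) ∧ Function.Injective (fun i => c i + τ i • v i) ∧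
      ∀ i, c i + τ i • v i ∈ U \ bad := by
  classical
  have step : ∀ i (B : Set E), B.Finite → ∃ τ : ℝ, τ ≠ 0 ∧ c i + τ • v i ∈ U \ B := by
    intro i B hB
    have hinj : Function.Injective (fun τ : ℝ => c i + τ • v i) := fun a b h =>
      smul_left_injective ℝ (hv i) (add_left_cancel h)
    have h1 : ∀ᶠ τ : ℝ in nhdsWithin 0 {0}ᶜ, c i + τ • v i ∈ U := by
      apply nhdsWithin_le_nhds
      have hcont : Continuous (fun τ : ℝ => c i + τ • v i) := by fun_prop
      exact hcont.continuousAt.eventually_mem (hU.mem_nhds (by simpa using hc i))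
    have h2 : ∀ᶠ τ : ℝ in nhdsWithin 0 {0}ᶜ, c i + τ • v i ∉ B := by
      have hfin : ((fun τ : ℝ => c i + τ • v i) ⁻¹' B \ {0}).Finite :=
        (hB.preimage hinj.injOn).subset Set.sdiff_subset
      filter_upwards [nhdsWithin_le_nhds (hfin.isClosed.isOpen_compl.mem_nhds
        (show (0 : ℝ) ∈ _ by simp)), self_mem_nhdsWithin] with τ h h' hB'
      exact h ⟨hB', h'⟩
    obtain ⟨τ, h, h', h''⟩ := (h1.and (h2.and self_mem_nhdsWithin)).exists
    exact ⟨τ, h'', h, h'⟩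
  have : Fintype ι := Fintype.ofFinite ι
  have main : ∀ s : Finset ι, ∃ τ : ι → ℝ, (∀ i ∈ s, τ i ≠ 0) ∧
      Set.InjOn (fun i => c i + τ i • v i) s ∧ ∀ i ∈ s, c i + τ i • v i ∈ U \ bad := by
    intro s
    induction s using Finset.induction_on with
    | empty => exact ⟨0, by simp⟩
    | insert i s hi ih =>
      obtain ⟨τ, h0, hinj, hmem⟩ := ih
      obtain ⟨t, ht0, htU, ht⟩ := step i (bad ∪ (fun j => c j + τ j • v j) '' s)
        (hbad.union (s.finite_toSet.image _))
      have hupd : ∀ j ∈ s, Function.update τ i t j = τ j := fun j hj =>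
        Function.update_of_ne (by rintro rfl; exact hi hj) _ _
      refine ⟨Function.update τ i t, ?_, ?_, ?_⟩
      · intro j hj
        rcases Finset.mem_insert.1 hj with rfl | hj
        · simpa using ht0
        · rw [hupd j hj]; exact h0 j hj
      · rw [Finset.coe_insert, Set.injOn_insert (by simpa using hi)]
        refine ⟨?_, ?_⟩
        · intro j hj k hk h
          simp only [hupd j hj, hupd k hk] at h
          exact hinj hj hk h
        · rintro ⟨j, hj, h⟩
          simp only [hupd j hj, Function.update_self] at h
          exact ht (Or.inr ⟨j, hj, h⟩)
      · intro j hj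
        rcases Finset.mem_insert.1 hj with rfl | hj
        · simp only [Function.update_self]
          exact ⟨htU, fun h => ht (Or.inl h)⟩
        · rw [hupd j hj]; exact hmem j hj
  obtain ⟨τ, h0, hinj, hmem⟩ := main Finset.univ
  exact ⟨τ, fun i => h0 i (Finset.mem_univ i), by simpa using hinj,
    fun i => hmem i (Finset.mem_univ i)⟩

/-- Finitely many nonconstant affine maps have a common point at which none of them vanishes. -/
theorem exists_forall_affine_ne_zero {E F ι : Type*} [AddCommGroup E] [Module ℝ E]
    [AddCommGroup F] [Module ℝ F] (s : Finset ι) (A : ι → E →ₗ[ℝ] F) (c : ι → F)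
    (hA : ∀ i ∈ s, A i ≠ 0) : ∃ g, ∀ i ∈ s, A i g + c i ≠ 0 := by
  classical
  induction s using Finset.induction_on with
  | empty => exact ⟨0, by simp⟩
  | insert i s hi ih =>
    obtain ⟨g, hg⟩ := ih fun j hj => hA j (Finset.mem_insert_of_mem hj)
    obtain ⟨v, hv⟩ : ∃ v, A i v ≠ 0 := by
      by_contra! h
      exact hA i (Finset.mem_insert_self i s) (LinearMap.ext h)
    -- On the line `g + t • v` each map is either nonconstant, with at most one zero, or constant
    -- with the nonzero value it has at `g`.
    have hfin : (⋃ j ∈ insert i s, {t : ℝ | A j (g + t • v) + c j = 0}).Finite := by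
      refine (insert i s).finite_toSet.biUnion fun j hj => Set.Subsingleton.finite ?_
      intro t ht t' ht'
      simp only [Set.mem_ofPred_eq, map_add, map_smul] at ht ht'
      have hd : (t - t') • A j v = 0 := by
        rw [sub_smul, sub_eq_zero]
        have := ht.trans ht'.symm
        simpa using this
      rcases smul_eq_zero.1 hd with h | h
      · exact sub_eq_zero.1 h
      · exfalso
        rcases Finset.mem_insert.1 hj with rfl | hj
        · exact hv h
        · apply hg j hj
          simpa [h] using ht
    obtain ⟨t, ht⟩ := hfin.infinite_compl.nonempty
    refine ⟨g + t • v, fun j hj h => ht ?_⟩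
    exact Set.mem_biUnion hj h

theorem exists_cross_ne_zero {a : Fin 3 → ℝ} (ha : a ≠ 0) : ∃ b, a ⨯₃ b ≠ 0 := by
  by_contra! h
  have h0 := h ![1, 0, 0]
  have h1 := h ![0, 1, 0]
  apply ha
  have e1 := congrFun h0 1
  have e2 := congrFun h0 2
  have e3 := congrFun h1 0
  have e4 := congrFun h1 2
  simp [cross_apply] at e1 e2 e3 e4
  ext i
  fin_cases i <;> simp [*]

/-- If `(a ⬝ᵥ m) • g - (g ⬝ᵥ m) • a` vanished for all `g`, every vector would be parallel to `a`
unless `a ⬝ᵥ m = 0`, and then `g = m` gives a contradiction. This makes the genericity conditions on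
the bar force nonconstant. -/
theorem exists_cross_cross_ne_zero {a m : Fin 3 → ℝ} (ha : a ≠ 0) (hm : m ≠ 0) :
    ∃ g, (a ⨯₃ g) ⨯₃ m ≠ 0 := by
  by_contra! h
  have h' : ∀ g, (a ⬝ᵥ m) • g = (g ⬝ᵥ m) • a := by
    intro g
    have := h g
    rw [cross_cross_eq_smul_sub_smul, sub_eq_zero] at this
    exact this
  have ham : a ⬝ᵥ m = 0 := by
    by_contra hne
    obtain ⟨b, hb⟩ := exists_cross_ne_zero ha
    apply hb
    have := congrArg (fun y => a ⨯₃ y) (h' b)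
    simp only [map_smul, cross_self, smul_zero, smul_eq_zero, hne, false_or] at this
    exact this
  have := h' m
  rw [ham, zero_smul, eq_comm, smul_eq_zero, dotProduct_self_eq_zero] at this
  tauto

/-- The vector `a ⨯₃ (a ⨯₃ b)` is orthogonal to `a` but not to `b` when `a ⨯₃ b ≠ 0`; the hinge axes
have this form. -/
theorem cross_cross_dotProduct_self (a b : Fin 3 → ℝ) : (a ⨯₃ (a ⨯₃ b)) ⬝ᵥ a = 0 := by
  rw [dotProduct_comm, dot_self_cross]

theorem cross_cross_dotProduct (a b : Fin 3 → ℝ) :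
    (a ⨯₃ (a ⨯₃ b)) ⬝ᵥ b = -((a ⨯₃ b) ⬝ᵥ (a ⨯₃ b)) := by
  simp only [cross_apply, vec3_dotProduct, Matrix.cons_val]
  ring

/-! ### Infinitesimal rigidity of a single body -/

/-- A displacement of the vertices of a right-angled tetrahedron that does not change its edges
is a rigid motion, and any further point joined to the four vertices follows that motion. -/
theorem exists_rigid_motion (z : Fin 3 → ℝ) (τ : Fin 3 → ℝ) (hτ : ∀ j, τ j ≠ 0)
    (uz : Fin 3 → ℝ) (e ue : Fin 3 → Fin 3 → ℝ) (he : ∀ j, e j = z + τ j • Pi.single j 1)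
    (h : ∀ j, (e j - z) ⬝ᵥ (ue j - uz) = 0)
    (h' : ∀ j k, (e j - e k) ⬝ᵥ (ue j - ue k) = 0) :
    ∃ ω v : Fin 3 → ℝ, ∀ y uy : Fin 3 → ℝ, (y - z) ⬝ᵥ (uy - uz) = 0 →
      (∀ j, (y - e j) ⬝ᵥ (uy - ue j) = 0) → uy = ω ⨯₃ y + v := by
  have hd : ∀ j, ue j j = uz j := by
    intro j
    have := h j
    rw [he, add_sub_cancel_left, smul_dotProduct, single_dotProduct] at this
    simpa [hτ, sub_eq_zero] using this
  have hs : ∀ j k, τ j * (ue k j - uz j) + τ k * (ue j k - uz k) = 0 := by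
    intro j k
    have := h' j k
    rw [he, he, add_sub_add_left_eq_sub, sub_dotProduct, smul_dotProduct, smul_dotProduct,
      single_dotProduct, single_dotProduct] at this
    simp only [Pi.sub_apply, one_mul, smul_eq_mul, hd] at this
    linear_combination -this
  -- By `hd` and `hs` the matrix of the `(ue j - uz) k / τ j` is antisymmetric; `ω` is its axial
  -- vector.
  let ω : Fin 3 → ℝ := ![(ue 1 2 - uz 2) / τ 1, (ue 2 0 - uz 0) / τ 2, (ue 0 1 - uz 1) / τ 0]
  refine ⟨ω, uz - ω ⨯₃ z, fun y uy hy hye => ?_⟩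
  -- The difference of the bar conditions at `z` and at `e j` isolates coordinate `j` of `uy`,
  -- because `e j - z` is a multiple of a basis vector.
  have hU : ∀ j, τ j * (uy j - uz j) + (y - z) ⬝ᵥ (ue j - uz) = 0 := by
    intro j
    have h1 := hye j
    have h2 := h j
    rw [he] at h1 h2
    have e1 : (y - (z + τ j • Pi.single j 1)) ⬝ᵥ (uy - ue j) =
        (y - z) ⬝ᵥ (uy - uz) - (y - z) ⬝ᵥ (ue j - uz) - τ j * (uy j - uz j)
          + (z + τ j • Pi.single j 1 - z) ⬝ᵥ (ue j - uz) := by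
      have : uy - ue j = (uy - uz) - (ue j - uz) := by abel
      rw [this, add_sub_cancel_left, sub_add_eq_sub_sub, sub_dotProduct (y - z), dotProduct_sub (y - z),
        smul_dotProduct, smul_dotProduct, dotProduct_sub (Pi.single j 1), single_dotProduct]
      simp only [Pi.sub_apply, one_mul, smul_eq_mul]
      ring
    rw [e1, hy, h2] at h1
    linear_combination -h1
  have s01 := hs 0 1
  have s02 := hs 0 2
  have s12 := hs 1 2
  have t0 := hτ 0
  have t1 := hτ 1
  have t2 := hτ 2
  have d0 := hd 0
  have d1 := hd 1
  have d2 := hd 2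
  have a10 : ue 1 0 - uz 0 = -(τ 1 * (ue 0 1 - uz 1) / τ 0) := by
    field_simp; linear_combination s01
  have a21 : ue 2 1 - uz 1 = -(τ 2 * (ue 1 2 - uz 2) / τ 1) := by
    field_simp; linear_combination s12
  have a02 : ue 0 2 - uz 2 = -(τ 0 * (ue 2 0 - uz 0) / τ 2) := by
    field_simp; linear_combination s02
  ext j
  apply mul_left_cancel₀ (hτ j)
  have hj := hU j
  simp only [vec3_dotProduct, Pi.sub_apply] at hj
  fin_cases j <;>
    simp only [Fin.zero_eta, Fin.mk_one, Fin.reduceFinMk, Fin.isValue] at hj ⊢ <;>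
    simp only [ω, cross_apply, Pi.add_apply, Pi.sub_apply, Matrix.cons_val] <;>
    simp only [a10, a21, a02, d0, d1, d2] at hj <;> field_simp at hj ⊢ <;> linear_combination hj

/-! ### The chain of bodies and its geometry -/

/-- Nodes of a chain of `n` rigid bodies. -/
inductive ChainNode (n : ℕ) : Type
  | barLeft : ChainNode n
  | barRight : ChainNode n
  | hinge : Fin n → ChainNode n
  | hinge' : Fin n → ChainNode n
  | load : Fin n → ChainNode n
  | frame : Fin n → Fin 3 → ChainNode n

namespace ChainNode

/-- Nodes as elements of a sum of finite types: first those that are positioned first. -/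
def toSum {n : ℕ} : ChainNode n → Option (Fin n) ⊕ Option (Fin n × (Bool ⊕ Fin 3))
  | barLeft => Sum.inl none
  | barRight => Sum.inr none
  | hinge i => Sum.inl (some i)
  | hinge' i => Sum.inr (some (i, Sum.inl false))
  | load i => Sum.inr (some (i, Sum.inl true))
  | frame i j => Sum.inr (some (i, Sum.inr j))

theorem toSum_injective {n : ℕ} : Function.Injective (toSum (n := n)) := by
  rintro (_ | _ | i | i | i | ⟨i, j⟩) (_ | _ | i' | i' | i' | ⟨i', j'⟩) h <;> simp_all [toSum]

noncomputable instance (n : ℕ) : Fintype (ChainNode n) := Fintype.ofInjective _ toSum_injective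

/-- The node belongs to the body with number `k`. Consecutive bodies share a pair of hinges. -/
def Mem {n : ℕ} : ChainNode n → ℕ → Prop
  | barLeft, k => k = 0
  | barRight, k => k + 1 = n
  | hinge i, k => k = i ∨ k + 1 = i
  | hinge' i, k => k = i ∨ k + 1 = i
  | load i, k => k = i
  | frame i _, k => k = i

/-- Two nodes are joined if they belong to the same body; moreover the first and the last body are
joined by the bar from `barLeft` to `barRight`. -/
def Joined {n : ℕ} (a b : ChainNode n) : Prop :=
  a ≠ b ∧ ((∃ k < n, a.Mem k ∧ b.Mem k) ∨ (a = barLeft ∧ b = barRight) ∨ (a = barRight ∧ b = barLeft))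

theorem Joined.symm {n : ℕ} {a b : ChainNode n} (h : Joined a b) : Joined b a := by
  obtain ⟨h, ⟨k, hk, ha, hb⟩ | ⟨ha, hb⟩ | ⟨ha, hb⟩⟩ := h
  · exact ⟨h.symm, Or.inl ⟨k, hk, hb, ha⟩⟩
  · exact ⟨h.symm, Or.inr (Or.inr ⟨hb, ha⟩)⟩
  · exact ⟨h.symm, Or.inr (Or.inl ⟨hb, ha⟩)⟩

end ChainNode

/-- The geometry of a closed chain of `n` rigid bodies, the `k`-th of which carries the force `F k`
at the point `X k`. Consecutive bodies are hinged along the line through `z k` with direction `d k`,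
and the first and the last body are joined by a bar from `a` to `b` that carries the force `g`.
The hinge is free for the resultant of `g` and the forces on the preceding bodies, but not for
`F k`. -/
structure BodyChain (n : ℕ) (X F : ℕ → Fin 3 → ℝ) where
  a : Fin 3 → ℝ
  b : Fin 3 → ℝ
  g : Fin 3 → ℝ
  z : ℕ → Fin 3 → ℝ
  z' : ℕ → Fin 3 → ℝ
  y : ℕ → Fin 3 → ℝ
  d : ℕ → Fin 3 → ℝ
  e : ℕ → Fin 3 → Fin 3 → ℝ
  bar : ∃ μ : ℝ, μ ≠ 0 ∧ b = a + μ • g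
  axis : ∀ k < n, ∃ μ : ℝ, μ ≠ 0 ∧ z' k = z k + μ • d k
  arm : ∀ k < n, ∃ μ : ℝ, μ ≠ 0 ∧ y k = X k + μ • F k
  frame : ∀ k < n, ∃ μ : Fin 3 → ℝ, (∀ j, μ j ≠ 0) ∧ ∀ j, e k j = z k + μ j • Pi.single j 1
  d_ne_zero : ∀ k < n, d k ≠ 0
  free : ∀ k < n, d k ⬝ᵥ ((a ⨯₃ g + ∑ j ∈ Finset.range k, X j ⨯₃ F j) -
    z k ⨯₃ (g + ∑ j ∈ Finset.range k, F j)) = 0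
  rigid : ∀ k < n, d k ⬝ᵥ ((X k - z k) ⨯₃ F k) ≠ 0

namespace BodyChain

variable {n : ℕ} {X F : ℕ → Fin 3 → ℝ}

/-- Position of the nodes. -/
def pos (C : BodyChain n X F) : ChainNode n → Fin 3 → ℝ
  | .barLeft => C.a
  | .barRight => C.b
  | .hinge i => C.z i
  | .hinge' i => C.z' i
  | .load i => C.y i
  | .frame i j => C.e i j

/-- A chain exists with all nodes close to the points of application of the forces. -/
theorem exists_pos_injective (hn : 0 < n) {U bad : Set (Fin 3 → ℝ)} (hU : IsOpen U)
    (hbad : bad.Finite) (hX : ∀ k < n, X k ∈ U) (hF : ∀ k < n, F k ≠ 0) :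
    ∃ C : BodyChain n X F, Function.Injective C.pos ∧ ∀ c, C.pos c ∈ U \ bad := by
  classical
  choose! E hE using fun k (hk : k < n) => exists_cross_ne_zero (hF k hk)
  have hE0 : ∀ k < n, E k ≠ 0 := by
    intro k hk h
    apply hE k hk
    rw [h, map_zero]
  -- Offsetting `z k` from `X k` along `E k` gives `F k` a nonzero moment about `z k`. The direction
  -- for `a` is arbitrary; what matters is that `a` differs from every `z k`.
  obtain ⟨τ, hτ0, hτ, hτU⟩ := exists_injective_add_smul hU hbad
    (fun i : Option (Fin n) => i.elim (X 0) fun i => X i)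
    (fun i => i.elim (Pi.single 0 1) fun i => E i)
    (by rintro (_ | i); exacts [hX 0 hn, hX i i.2])
    (by rintro (_ | i); exacts [by simp, hE0 i i.2])
  set P₁ : Option (Fin n) → Fin 3 → ℝ := fun i =>
    i.elim (X 0) (fun i => X i) + τ i • i.elim (Pi.single 0 1) (fun i => E i) with hP₁
  set a := P₁ none with ha
  set z : ℕ → Fin 3 → ℝ := fun k => if h : k < n then P₁ (some ⟨k, h⟩) else 0 with hz
  have hzi : ∀ i : Fin n, z i = P₁ (some i) := fun i => by simp [hz]
  have hm : ∀ k < n, (X k - z k) ⨯₃ F k ≠ 0 := by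
    intro k hk h
    have h1 : X k - z k = -(τ (some ⟨k, hk⟩) • E k) := by
      rw [show z k = P₁ (some ⟨k, hk⟩) from hzi ⟨k, hk⟩]
      simp [hP₁]
    rw [h1, map_neg, LinearMap.neg_apply, map_smul, LinearMap.smul_apply, neg_eq_zero,
      smul_eq_zero, ← neg_eq_zero (a := _ ⨯₃ _), cross_anticomm] at h
    exact h.elim (hτ0 _) (hE k hk)
  have haz : ∀ k < n, a - z k ≠ 0 := by
    intro k hk h
    rw [show z k = P₁ (some ⟨k, hk⟩) from hzi ⟨k, hk⟩, sub_eq_zero] at h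
    exact absurd (hτ h) (by simp)
  -- The index `none` ensures `g ≠ 0`; the index `some i` ensures that the moment `M i` of the
  -- resultant about `z i` is not parallel to that of `F i`.
  obtain ⟨g, hg⟩ := exists_forall_affine_ne_zero (Finset.univ : Finset (Option (Fin n)))
    (fun i => i.elim LinearMap.id fun i =>
      (crossProduct.flip ((X i - z i) ⨯₃ F i)) ∘ₗ crossProduct (a - z i))
    (fun i => i.elim 0 fun i => ((∑ j ∈ Finset.range i, X j ⨯₃ F j) -
      z i ⨯₃ (∑ j ∈ Finset.range i, F j)) ⨯₃ ((X i - z i) ⨯₃ F i))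
    (by
      rintro (_ | i) -
      · intro h
        have := LinearMap.congr_fun h (Pi.single 0 1)
        simp at this
      · intro h
        obtain ⟨v, hv⟩ := exists_cross_cross_ne_zero (haz i i.2) (hm i i.2)
        exact hv (LinearMap.congr_fun h v))
  have hg0 : g ≠ 0 := by simpa using hg none (Finset.mem_univ _)
  set M : ℕ → Fin 3 → ℝ := fun k => (a ⨯₃ g + ∑ j ∈ Finset.range k, X j ⨯₃ F j) -
    z k ⨯₃ (g + ∑ j ∈ Finset.range k, F j) with hM
  have hMm : ∀ k < n, M k ⨯₃ ((X k - z k) ⨯₃ F k) ≠ 0 := by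
    intro k hk
    have := hg (some ⟨k, hk⟩) (Finset.mem_univ _)
    convert this using 1
    simp only [hM, Option.elim, LinearMap.comp_apply, LinearMap.flip_apply]
    rw [← LinearMap.add_apply, ← map_add]
    congr 2
    simp only [map_add, map_sub, LinearMap.sub_apply]
    ring
  set d : ℕ → Fin 3 → ℝ := fun k => M k ⨯₃ (M k ⨯₃ ((X k - z k) ⨯₃ F k)) with hd
  have hrigid : ∀ k < n, d k ⬝ᵥ ((X k - z k) ⨯₃ F k) ≠ 0 := by
    intro k hk h
    rw [hd, cross_cross_dotProduct, neg_eq_zero, dotProduct_self_eq_zero] at h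
    exact hMm k hk h
  have hd0 : ∀ k < n, d k ≠ 0 := by
    intro k hk h
    apply hrigid k hk
    rw [h, zero_dotProduct]
  -- The remaining nodes lie on lines fixed by the choices above, so they are placed afterwards,
  -- avoiding `P₁` too.
  obtain ⟨σ, hσ0, hσ, hσU⟩ := exists_injective_add_smul hU (hbad.union (Set.finite_range P₁))
    (fun i : Option (Fin n × (Bool ⊕ Fin 3)) => i.elim a fun i =>
      Sum.elim (fun t => cond t (X i.1) (z i.1)) (fun _ => z i.1) i.2)
    (fun i => i.elim g fun i =>
      Sum.elim (fun t => cond t (F i.1) (d i.1)) (fun j => Pi.single j 1) i.2)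
    (by
      rintro (_ | ⟨i, (_ | _) | j⟩)
      · exact (hτU none).1
      · change z i ∈ U
        rw [hzi]
        exact (hτU (some i)).1
      · exact hX i i.2
      · change z i ∈ U
        rw [hzi]
        exact (hτU (some i)).1)
    (by
      rintro (_ | ⟨i, (_ | _) | j⟩)
      exacts [hg0, hd0 i i.2, hF i i.2, by simp])
  set P₂ : Option (Fin n × (Bool ⊕ Fin 3)) → Fin 3 → ℝ := fun i =>
    (i.elim a fun i => Sum.elim (fun t => cond t (X i.1) (z i.1)) (fun _ => z i.1) i.2) +
      σ i • (i.elim g fun i =>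
        Sum.elim (fun t => cond t (F i.1) (d i.1)) (fun j => Pi.single j 1) i.2) with hP₂
  let C : BodyChain n X F :=
    { a := a
      b := P₂ none
      g := g
      z := z
      z' := fun k => if h : k < n then P₂ (some (⟨k, h⟩, Sum.inl false)) else 0
      y := fun k => if h : k < n then P₂ (some (⟨k, h⟩, Sum.inl true)) else 0
      d := d
      e := fun k j => if h : k < n then P₂ (some (⟨k, h⟩, Sum.inr j)) else 0
      bar := ⟨σ none, hσ0 _, rfl⟩
      axis := fun k hk => ⟨_, hσ0 (some (⟨k, hk⟩, Sum.inl false)), by rw [dif_pos hk]; rfl⟩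
      arm := fun k hk => ⟨_, hσ0 (some (⟨k, hk⟩, Sum.inl true)), by rw [dif_pos hk]; rfl⟩
      frame := fun k hk => ⟨_, fun j => hσ0 (some (⟨k, hk⟩, Sum.inr j)),
        fun j => by rw [dif_pos hk]; rfl⟩
      d_ne_zero := hd0
      free := fun k _ => cross_cross_dotProduct_self _ _
      rigid := hrigid }
  have hC : C.pos = Sum.elim P₁ P₂ ∘ ChainNode.toSum := by
    ext1 c
    rcases c with (_ | _ | i | i | i | ⟨i, j⟩) <;>
      simp [pos, C, ChainNode.toSum, hzi, ha]
  refine ⟨C, ?_, fun c => ?_⟩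
  · rw [hC]
    refine Function.Injective.comp ?_ ChainNode.toSum_injective
    exact hτ.sumElim hσ fun i j h => (hσU j).2 (Or.inr ⟨i, h⟩)
  · rw [hC, Function.comp_apply]
    rcases c.toSum with i | i
    · exact hτU i
    · exact ⟨(hσU i).1, fun h => (hσU i).2 (Or.inl h)⟩

/-! ### Virtual work and motions of the chain -/

theorem exists_eq_smul_of_cross_eq_zero {s d : Fin 3 → ℝ} (hd : d ≠ 0) (h : s ⨯₃ d = 0) :
    ∃ t : ℝ, s = t • d := by
  have hdd : d ⬝ᵥ d ≠ 0 := by rwa [Ne, dotProduct_self_eq_zero]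
  refine ⟨(d ⬝ᵥ s) / (d ⬝ᵥ d), ?_⟩
  have h2 := cross_cross_eq_smul_sub_smul s d d
  rw [h, LinearMap.map_zero, LinearMap.zero_apply] at h2
  rw [div_eq_inv_mul, mul_smul, eq_inv_smul_iff₀ hdd, dotProduct_comm d s]
  rw [eq_comm, sub_eq_zero] at h2
  exact h2.symm

theorem dotProduct_cross_add (f x ω v : Fin 3 → ℝ) :
    f ⬝ᵥ (ω ⨯₃ x + v) = f ⬝ᵥ v + (x ⨯₃ f) ⬝ᵥ ω := by
  simp only [cross_apply, vec3_dotProduct, Matrix.cons_val, Pi.add_apply]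
  ring

/-- The virtual work of the forces under motions of the bodies that respect the hinges. -/
theorem sum_work (C : BodyChain n X F) (hn : 0 < n) (hF : ∑ k ∈ Finset.range n, F k = 0)
    (hXF : ∑ k ∈ Finset.range n, X k ⨯₃ F k = 0) (ω v : ℕ → Fin 3 → ℝ)
    (h : ∀ k, k + 1 < n → ω k ⨯₃ C.z (k + 1) + v k = ω (k + 1) ⨯₃ C.z (k + 1) + v (k + 1))
    (h' : ∀ k, k + 1 < n → ω k ⨯₃ C.z' (k + 1) + v k = ω (k + 1) ⨯₃ C.z' (k + 1) + v (k + 1)) :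
    ∑ k ∈ Finset.range n, F k ⬝ᵥ (ω k ⨯₃ X k + v k) =
      C.g ⬝ᵥ ((ω (n - 1) ⨯₃ C.b + v (n - 1)) - (ω 0 ⨯₃ C.a + v 0)) := by
  -- The work of the first `k + 1` forces is the work of their resultant with `g` on body `k`, less
  -- the work of `g` at `a`.
  have key : ∀ k < n, ∑ j ∈ Finset.range (k + 1), F j ⬝ᵥ (ω j ⨯₃ X j + v j) =
      ((C.g + ∑ j ∈ Finset.range (k + 1), F j) ⬝ᵥ v k +
        (C.a ⨯₃ C.g + ∑ j ∈ Finset.range (k + 1), X j ⨯₃ F j) ⬝ᵥ ω k) -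
      C.g ⬝ᵥ (ω 0 ⨯₃ C.a + v 0) := by
    intro k
    induction k with
    | zero =>
      intro _
      simp only [zero_add, Finset.range_one, Finset.sum_singleton, dotProduct_cross_add,
        add_dotProduct]
      ring
    | succ k ih =>
      intro hk
      rw [Finset.sum_range_succ, ih (by omega), Finset.sum_range_succ _ (k + 1),
        Finset.sum_range_succ _ (k + 1), dotProduct_cross_add (F (k + 1))]
      set G := C.g + ∑ j ∈ Finset.range (k + 1), F j with hG
      set T := C.a ⨯₃ C.g + ∑ j ∈ Finset.range (k + 1), X j ⨯₃ F j with hT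
      have hfree : C.d (k + 1) ⬝ᵥ (T - C.z (k + 1) ⨯₃ G) = 0 := C.free (k + 1) hk
      obtain ⟨μ, hμ, hz'⟩ := C.axis (k + 1) hk
      have hz := h k hk
      have hw := h' k hk
      rw [hz', map_add, map_add, add_right_comm, hz, add_right_comm, add_left_inj,
        add_right_inj, map_smul, map_smul] at hw
      -- Agreement at two points of the axis makes the relative motion of the two bodies a rotation
      -- about it, on which the resultant does no work by `free`.
      have hcr : (ω k - ω (k + 1)) ⨯₃ C.d (k + 1) = 0 := by
        rw [map_sub, LinearMap.sub_apply, sub_eq_zero]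
        exact smul_right_injective _ hμ hw
      obtain ⟨t, ht⟩ := exists_eq_smul_of_cross_eq_zero (C.d_ne_zero _ hk) hcr
      have hv : v k = v (k + 1) - (ω k - ω (k + 1)) ⨯₃ C.z (k + 1) := by
        rw [map_sub, LinearMap.sub_apply]
        linear_combination hz
      have hω : ω k = ω (k + 1) + t • C.d (k + 1) := by rw [← ht]; abel
      have e1 : G ⬝ᵥ v k + T ⬝ᵥ ω k = G ⬝ᵥ v (k + 1) + T ⬝ᵥ ω (k + 1) := by
        rw [hv, ht, hω]
        have : G ⬝ᵥ (v (k + 1) - (t • C.d (k + 1)) ⨯₃ C.z (k + 1)) +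
            T ⬝ᵥ (ω (k + 1) + t • C.d (k + 1)) = G ⬝ᵥ v (k + 1) + T ⬝ᵥ ω (k + 1) +
            t * (C.d (k + 1) ⬝ᵥ (T - C.z (k + 1) ⨯₃ G)) := by
          simp only [cross_apply, vec3_dotProduct, Matrix.cons_val, Pi.add_apply, Pi.sub_apply,
            Pi.smul_apply, smul_eq_mul]
          ring
        rw [this, hfree, mul_zero, add_zero]
      rw [e1, ← add_assoc C.g, ← add_assoc (C.a ⨯₃ C.g), add_dotProduct G, add_dotProduct T]
      ring
  obtain ⟨m, rfl⟩ : ∃ m, n = m + 1 := ⟨n - 1, by omega⟩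
  rw [key m (by omega), hF, hXF, add_zero, add_zero, Nat.add_sub_cancel, dotProduct_sub]
  congr 1
  -- Balance leaves only the wrench of `g`; its moment may be taken at `b` instead of `a`, as both
  -- lie on its line of action.
  obtain ⟨μ, -, hb⟩ := C.bar
  rw [hb]
  simp only [cross_apply, vec3_dotProduct, Matrix.cons_val, Pi.add_apply,
    Pi.smul_apply, smul_eq_mul]
  ring

/-- The bodies can be moved, respecting the hinges, so that each force does a given work. -/
theorem exists_motion (C : BodyChain n X F) (t : ℕ → ℝ) :
    ∃ ω v : ℕ → Fin 3 → ℝ, (∀ k < n, F k ⬝ᵥ (ω k ⨯₃ X k + v k) = t k) ∧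
      ∀ k, k + 1 < n →
        ω k ⨯₃ C.z (k + 1) + v k = ω (k + 1) ⨯₃ C.z (k + 1) + v (k + 1) ∧
        ω k ⨯₃ C.z' (k + 1) + v k = ω (k + 1) ⨯₃ C.z' (k + 1) + v (k + 1) := by
  -- The angle of the rotation about hinge `k` that corrects the work of `F k` to `t k`. Hinge `0`
  -- belongs to body `0` only, so the recursion may start there from rest.
  let step : ℕ → (Fin 3 → ℝ) × (Fin 3 → ℝ) → ℝ := fun k r =>
    (t k - F k ⬝ᵥ (r.1 ⨯₃ X k + r.2)) / (C.d k ⬝ᵥ ((X k - C.z k) ⨯₃ F k))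
  let next : ℕ → (Fin 3 → ℝ) × (Fin 3 → ℝ) → (Fin 3 → ℝ) × (Fin 3 → ℝ) := fun k r =>
    (r.1 + step k r • C.d k, r.2 - (step k r • C.d k) ⨯₃ C.z k)
  let ρ : ℕ → (Fin 3 → ℝ) × (Fin 3 → ℝ) := fun k => Nat.rec (next 0 0) (fun k r => next (k + 1) r) k
  have hnext : ∀ k < n, ∀ r, F k ⬝ᵥ ((next k r).1 ⨯₃ X k + (next k r).2) = t k := by
    intro k hk r
    have : F k ⬝ᵥ ((next k r).1 ⨯₃ X k + (next k r).2) = F k ⬝ᵥ (r.1 ⨯₃ X k + r.2) +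
        step k r * (C.d k ⬝ᵥ ((X k - C.z k) ⨯₃ F k)) := by
      simp only [next, cross_apply, vec3_dotProduct, Matrix.cons_val, Pi.add_apply, Pi.sub_apply,
        Pi.smul_apply, smul_eq_mul]
      ring
    rw [this, div_mul_cancel₀ _ (C.rigid k hk)]
    ring
  refine ⟨fun k => (ρ k).1, fun k => (ρ k).2, ?_, ?_⟩
  · rintro (_ | k) hk
    · exact hnext 0 hk _
    · exact hnext (k + 1) hk _
  · intro k hk
    have hs : ρ (k + 1) = next (k + 1) (ρ k) := rfl
    obtain ⟨μ, -, hz'⟩ := C.axis (k + 1) hk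
    rw [hz']
    constructor
    · simp only [hs, next, map_add, LinearMap.add_apply]
      abel
    · simp only [hs, next, map_add, LinearMap.add_apply, map_smul, LinearMap.smul_apply, cross_self,
        smul_zero]
      abel_nf

/-- In a flex of the framework every body moves rigidly. -/
theorem exists_motion_of_flex (C : BodyChain n X F) (u : ChainNode n → Fin 3 → ℝ)
    (hu : ∀ a b, ChainNode.Joined a b → (C.pos b - C.pos a) ⬝ᵥ (u b - u a) = 0) :
    ∃ ω v : ℕ → Fin 3 → ℝ, ∀ k < n, ∀ c : ChainNode n, c.Mem k → u c = ω k ⨯₃ C.pos c + v k := by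
  have hu' : ∀ k < n, ∀ a b : ChainNode n, a.Mem k → b.Mem k →
      (C.pos b - C.pos a) ⬝ᵥ (u b - u a) = 0 := by
    intro k hk a b ha hb
    by_cases hab : a = b
    · simp [hab]
    · exact hu a b ⟨hab, Or.inl ⟨k, hk, ha, hb⟩⟩
  have : ∀ k < n, ∃ ω v : Fin 3 → ℝ, ∀ c : ChainNode n, c.Mem k → u c = ω ⨯₃ C.pos c + v := by
    intro k hk
    obtain ⟨μ, hμ, he⟩ := C.frame k hk
    have hz : (ChainNode.hinge ⟨k, hk⟩).Mem k := Or.inl rfl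
    have hfr : ∀ j, (ChainNode.frame ⟨k, hk⟩ j).Mem k := fun _ => rfl
    obtain ⟨ω, v, h⟩ := exists_rigid_motion (C.z k) μ hμ (u (.hinge ⟨k, hk⟩)) (C.e k)
      (fun j => u (.frame ⟨k, hk⟩ j)) he (fun j => hu' k hk _ _ hz (hfr j))
      (fun j l => hu' k hk _ _ (hfr l) (hfr j))
    exact ⟨ω, v, fun c hc => h _ _ (hu' k hk _ _ hz hc) fun j => hu' k hk _ _ (hfr j) hc⟩
  choose! ω v h using this
  exact ⟨ω, v, h⟩

/-- Motions of the bodies that respect the hinges define displacements of the nodes. -/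
theorem exists_displacement (C : BodyChain n X F) (hn : 0 < n) (ω v : ℕ → Fin 3 → ℝ)
    (h : ∀ k, k + 1 < n →
        ω k ⨯₃ C.z (k + 1) + v k = ω (k + 1) ⨯₃ C.z (k + 1) + v (k + 1) ∧
        ω k ⨯₃ C.z' (k + 1) + v k = ω (k + 1) ⨯₃ C.z' (k + 1) + v (k + 1)) :
    ∃ u : ChainNode n → Fin 3 → ℝ, ∀ k < n, ∀ c : ChainNode n, c.Mem k →
      u c = ω k ⨯₃ C.pos c + v k := by
  have : ∀ c : ChainNode n, ∃ w, ∀ k < n, c.Mem k → w = ω k ⨯₃ C.pos c + v k := by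
    rintro (_ | _ | i | i | i | ⟨i, j⟩)
    · exact ⟨_, by rintro k hk rfl; rfl⟩
    · refine ⟨ω (n - 1) ⨯₃ C.b + v (n - 1), fun k hk hm => ?_⟩
      obtain rfl : k = n - 1 := by have : k + 1 = n := hm; omega
      rfl
    · refine ⟨ω i ⨯₃ C.z i + v i, fun k hk hm => ?_⟩
      rcases hm with rfl | hm
      · rfl
      · change _ = ω k ⨯₃ C.z i + v k
        have hi := i.2
        rw [← hm] at hi ⊢
        exact (h k hi).1.symm
    · refine ⟨ω i ⨯₃ C.z' i + v i, fun k hk hm => ?_⟩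
      rcases hm with rfl | hm
      · rfl
      · change _ = ω k ⨯₃ C.z' i + v k
        have hi := i.2
        rw [← hm] at hi ⊢
        exact (h k hi).2.symm
    · exact ⟨_, by rintro k hk rfl; rfl⟩
    · exact ⟨_, by rintro k hk rfl; rfl⟩
  choose u hu using this
  exact ⟨u, fun k hk c hc => hu c k hk hc⟩

end BodyChain

/-! ### Assembly of the network -/

theorem mainTheorem5 (p : ℕ) (x f : Fin p → Space3) (hf : IsBalanced x f)
    (ε : ℝ) (hε : 0 < ε) (S : Set Space3) (hS : S.Finite) :
    ∃ (N : ElasticNetwork x) (c : ℝ), 0 < c ∧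
      N.IsResponse (c • Matrix.vecMulVec (stackForces f) (stackForces f)) ∧
      ∀ j, N.interior j ∈ Metric.cthickening ε (convexHull ℝ (Set.range x)) ∧
        N.interior j ∉ S := by
  classical
  by_cases hf0 : f = 0
  · let N : ElasticNetwork x :=
      { m := 0
        interior := Fin.elim0
        interior_injective := fun i => i.elim0
        interior_ne_terminal := fun i => i.elim0
        k := 0
        k_symm := fun _ _ => rfl
        k_nonneg := fun _ _ => le_rfl
        ne_of_spring := fun _ _ h => absurd rfl h }
    have hs : stackForces f = 0 := by
      ext c
      simp [stackForces, hf0]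
    refine ⟨N, 1, one_pos, ⟨by simp [hs, Matrix.IsSymm], fun b => ?_⟩, fun j => j.elim0⟩
    have hq : ∀ u, N.quadForm u = 0 := by
      intro u
      rw [ElasticNetwork.quadForm_eq]
      simp [N]
    simp [hq, hs]
  -- Only loaded terminals get a body, since the bar at a terminal needs the direction of its force;
  -- the other terminals stay without springs.
  set n := Fintype.card {i // f i ≠ 0} with hn
  let σ : Fin n ≃ {i // f i ≠ 0} := (Fintype.equivFin _).symm
  have hn0 : 0 < n := by
    obtain ⟨i, hi⟩ : ∃ i, f i ≠ 0 := Function.ne_iff.1 hf0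
    exact Fintype.card_pos_iff.2 ⟨⟨i, hi⟩⟩
  let ext : (Fin p → Fin 3 → ℝ) → ℕ → Fin 3 → ℝ := fun w k =>
    if h : k < n then w (σ ⟨k, h⟩) else 0
  have hext : ∀ w (k : Fin n), ext w k = w (σ k) := fun w k => by simp [ext]
  have hsum : ∀ {A : Type} [AddCommMonoid A] (w : Fin p → A) (w' : ℕ → A),
      (∀ k : Fin n, w' k = w (σ k)) → (∀ i, f i = 0 → w i = 0) →
      ∑ k ∈ Finset.range n, w' k = ∑ i, w i := by
    intro A _ w w' h h0
    rw [Finset.sum_range, Finset.sum_congr rfl fun k _ => h k,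
      Equiv.sum_comp σ fun i => w i, ← Finset.sum_subtype (Finset.univ.filter (f · ≠ 0)) (by simp) w]
    exact Finset.sum_filter_of_ne fun i _ hi h => hi (h0 i h)
  set X := ext fun i => (x i).ofLp with hX
  set F := ext fun i => (f i).ofLp with hF
  have hXi : ∀ k : Fin n, X k = (x (σ k)).ofLp := hext fun i => (x i).ofLp
  have hFi : ∀ k : Fin n, F k = (f (σ k)).ofLp := hext fun i => (f i).ofLp
  have hFsum : ∑ k ∈ Finset.range n, F k = 0 := by
    rw [hsum (fun i => (f i).ofLp) F hFi (by simp +contextual), ← WithLp.ofLp_sum, hf.1]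
    rfl
  have hXFsum : ∑ k ∈ Finset.range n, X k ⨯₃ F k = 0 := by
    rw [hsum (fun i => (x i).ofLp ⨯₃ (f i).ofLp) _ (fun k => by rw [hXi, hFi])
      (by simp +contextual), hf.2]
  have hwork : ∀ (u : Fin p → Fin 3 → ℝ) (w : ℕ → ℝ),
      (∀ k : Fin n, w k = (f (σ k)).ofLp ⬝ᵥ u (σ k)) →
      ∑ k ∈ Finset.range n, w k = ∑ i, (f i).ofLp ⬝ᵥ u i := fun u w h =>
    hsum _ _ h (by simp +contextual)
  set U := Metric.thickening ε (convexHull ℝ (Set.range x)) with hU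
  obtain ⟨C, hCinj, hC⟩ := BodyChain.exists_pos_injective (X := X) (F := F) hn0
    (U := WithLp.toLp 2 ⁻¹' U) (bad := WithLp.toLp 2 ⁻¹' (S ∪ Set.range x))
    (Metric.isOpen_thickening.preimage (PiLp.continuous_toLp 2 _))
    ((hS.union (Set.finite_range x)).preimage (WithLp.toLp_injective 2).injOn)
    (fun k hk => by
      rw [Set.mem_preimage, show X k = _ from hXi ⟨k, hk⟩]
      exact Metric.self_subset_thickening hε _ (subset_convexHull ℝ _ ⟨_, rfl⟩))
    (fun k hk => by
      rw [show F k = _ from hFi ⟨k, hk⟩]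
      exact fun h => (σ ⟨k, hk⟩).2 (WithLp.ofLp_injective 2 h))
  let P : ChainNode n → Space3 := fun c => WithLp.toLp 2 (C.pos c)
  let adj : Fin p ⊕ ChainNode n → Fin p ⊕ ChainNode n → Prop := fun a b =>
    (∃ k, a = Sum.inl (σ k).1 ∧ b = Sum.inr (.load k)) ∨
    (∃ k, a = Sum.inr (.load k) ∧ b = Sum.inl (σ k).1) ∨
    ∃ c c', a = Sum.inr c ∧ b = Sum.inr c' ∧ c.Joined c'
  have hPx : ∀ c i, P c ≠ x i := fun c i h => (hC c).2 (Or.inr ⟨i, h.symm⟩)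
  obtain ⟨μ, hμ, hbar⟩ := C.bar
  have hload : ∀ (k : Fin n), ∃ ν : ℝ, ν ≠ 0 ∧ ∀ w,
      (P (.load k) - x (σ k)).ofLp ⬝ᵥ w = ν * ((f (σ k)).ofLp ⬝ᵥ w) := by
    intro k
    obtain ⟨ν, hν, hy⟩ := C.arm k k.2
    refine ⟨ν, hν, fun w => ?_⟩
    have : (P (.load k) - x (σ k)).ofLp = ν • (f (σ k)).ofLp := by
      change C.y k - (x (σ k)).ofLp = _
      rw [hy, hXi, hFi, add_sub_cancel_left]
    rw [this, smul_dotProduct, smul_eq_mul]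
  -- A force may slide along its line of action without changing its work on a rigid motion.
  have harm : ∀ (ω v : Fin 3 → ℝ) (k : Fin n),
      F k ⬝ᵥ (ω ⨯₃ C.pos (.load k) + v) = F k ⬝ᵥ (ω ⨯₃ X k + v) := by
    intro ω v k
    obtain ⟨ν, -, hy⟩ := C.arm k k.2
    change F k ⬝ᵥ (ω ⨯₃ C.y k + v) = _
    rw [hy, map_add, map_smul, add_right_comm, dotProduct_add, dotProduct_smul, dot_cross_self,
      smul_zero, add_zero]
  have hleft : (ChainNode.barLeft (n := n)).Mem 0 := rfl
  have hright : (ChainNode.barRight (n := n)).Mem (n - 1) := Nat.sub_add_cancel hn0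
  obtain ⟨N, c, hc, hN, hNP⟩ := exists_network_of_framework hf0 P
    ((WithLp.toLp_injective 2).comp hCinj) hPx adj
    (by
      rintro a b (⟨k, h, h'⟩ | ⟨k, h, h'⟩ | ⟨c, c', h, h', hj⟩)
      · exact Or.inr (Or.inl ⟨k, h', h⟩)
      · exact Or.inl ⟨k, h', h⟩
      · exact Or.inr (Or.inr ⟨c', c, h', h, hj.symm⟩))
    (by
      rintro _ _ (⟨k, rfl, rfl⟩ | ⟨k, rfl, rfl⟩ | ⟨c, c', rfl, rfl, hj⟩)
      · exact (hPx _ _).symm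
      · exact hPx _ _
      · exact fun h => hj.1 (hCinj (WithLp.toLp_injective 2 h)))
    (by
      intro u hu
      obtain ⟨ω, v, hrig⟩ := C.exists_motion_of_flex (fun c => u (Sum.inr c)) fun a b hab =>
        hu _ _ (Or.inr (Or.inr ⟨a, b, rfl, rfl, hab⟩))
      have hsw := C.sum_work hn0 hFsum hXFsum ω v
        (fun k hk => (hrig k (by omega) (.hinge ⟨k + 1, hk⟩) (Or.inr rfl)).symm.trans
          (hrig (k + 1) hk (.hinge ⟨k + 1, hk⟩) (Or.inl rfl)))
        (fun k hk => (hrig k (by omega) (.hinge' ⟨k + 1, hk⟩) (Or.inr rfl)).symm.trans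
          (hrig (k + 1) hk (.hinge' ⟨k + 1, hk⟩) (Or.inl rfl)))
      have hab := hu (Sum.inr .barLeft) (Sum.inr .barRight)
        (Or.inr (Or.inr ⟨_, _, rfl, rfl, by simp, Or.inr (Or.inl ⟨rfl, rfl⟩)⟩))
      have hba : (Sum.elim x P (Sum.inr .barRight) - Sum.elim x P (Sum.inr .barLeft)).ofLp = μ • C.g := by
        change C.b - C.a = _
        rw [hbar, add_sub_cancel_left]
      rw [hba, smul_dotProduct, smul_eq_mul, mul_eq_zero, or_iff_right hμ,
        hrig 0 hn0 _ hleft, hrig (n - 1) (by omega) _ hright] at hab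
      change C.g ⬝ᵥ ((ω (n - 1) ⨯₃ C.b + v (n - 1)) - (ω 0 ⨯₃ C.a + v 0)) = 0 at hab
      rw [← hwork _ (fun k => F k ⬝ᵥ (ω k ⨯₃ X k + v k)), hsw, hab]
      intro k
      obtain ⟨ν, hν, hw⟩ := hload k
      have := hu (Sum.inl (σ k).1) (Sum.inr (.load k)) (Or.inl ⟨k, rfl, rfl⟩)
      have h2 := hw (u (Sum.inr (.load k)) - u (Sum.inl (σ k).1))
      change (P (.load k) - x (σ k)).ofLp ⬝ᵥ _ = 0 at this
      rw [this, eq_comm, mul_eq_zero, or_iff_right hν, dotProduct_sub, sub_eq_zero,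
        hrig k k.2 (.load k) rfl, ← hFi, harm] at h2
      rw [← hFi]
      exact h2)
    (by
      intro w hw
      obtain ⟨ω, v, ht, hh⟩ := C.exists_motion fun k => F k ⬝ᵥ ext w k
      obtain ⟨u, hu⟩ := C.exists_displacement hn0 ω v hh
      have hsw := C.sum_work hn0 hFsum hXFsum ω v (fun k hk => (hh k hk).1) fun k hk => (hh k hk).2
      -- The prescribed works sum to zero, so the work identity makes the closing bar unstrained.
      rw [hwork w _ fun k => by rw [ht k k.2, hFi, hext], hw, eq_comm] at hsw
      have hend : (C.pos .barRight - C.pos .barLeft) ⬝ᵥ (u .barRight - u .barLeft) = 0 := by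
        rw [hu 0 hn0 _ hleft, hu (n - 1) (by omega) _ hright]
        change (C.b - C.a) ⬝ᵥ ((ω (n - 1) ⨯₃ C.b + v (n - 1)) - (ω 0 ⨯₃ C.a + v 0)) = 0
        have hba : C.b - C.a = μ • C.g := by rw [hbar, add_sub_cancel_left]
        rw [hba, smul_dotProduct, hsw, smul_zero]
      have hk : ∀ k : Fin n,
          (P (.load k) - x (σ k)).ofLp ⬝ᵥ (u (.load k) - w (σ k)) = 0 := by
        intro k
        obtain ⟨ν, -, h⟩ := hload k
        rw [h, ← hFi, dotProduct_sub, hu k k.2 (.load k) rfl, harm, ht k k.2, hext, sub_self, mul_zero]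
      have hneg : ∀ a b c d : Fin 3 → ℝ, (a - b) ⬝ᵥ (c - d) = 0 → (b - a) ⬝ᵥ (d - c) = 0 := by
        intro a b c d h
        rw [← neg_sub a, ← neg_sub c, neg_dotProduct_neg, h]
      refine ⟨Sum.elim w u, fun _ => rfl, ?_⟩
      rintro _ _ (⟨k, rfl, rfl⟩ | ⟨k, rfl, rfl⟩ | ⟨c, c', rfl, rfl, -, hj⟩)
      · exact hk k
      · exact hneg _ _ _ _ (hk k)
      · change (C.pos c' - C.pos c) ⬝ᵥ (u c' - u c) = 0
        obtain ⟨k, hk, hc, hc'⟩ | ⟨rfl, rfl⟩ | ⟨rfl, rfl⟩ := hj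
        · rw [hu k hk c hc, hu k hk c' hc', add_sub_add_right_eq_sub, ← map_sub, dot_cross_self]
        · exact hend
        · exact hneg _ _ _ _ hend)
  refine ⟨N, c, hc, hN, fun j => ?_⟩
  obtain ⟨i, hi⟩ := hNP j
  rw [hi]
  exact ⟨Metric.thickening_subset_cthickening _ _ (hC i).1, fun h => (hC i).2 (Or.inl h)⟩
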